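/- Let $R$ be an associative ring with unit and let $M\neq 0$ be a unitary left $R$-module. Let $\sigma[M]$ be the full subcategory of $R$-Mod whose objects are the modules isomorphic to a submodule of an $M$-generated module (a quotient of a direct sum of copies of $M$), and let $\widehat{M}$ be the $M$-injective hull of $M$, i.e. the module $\widehat M\in\sigma[M]$, unique up to isomorphism, that is $M$-injective (every homomorphism from a submodule of $M$ to $\widehat M$ extends to $M$) and contains $M$ as an essential submodule. For submodules $K,L\leq M$ put $K_ML=\sum\{f(K)\mid f\in \mathrm{Hom}_R(M,L)\}$. A submodule is fully invariant if every endomorphism of $M$ maps it into itself. The module $M$ is called * prime if for all fully invariant $K,L\leq M$ with $K_ML=0$ we have $K=0$ or $L=0$; * semiprime if for every fully invariant $K\leq M$ with $K_MK=0$ we have $K=0$; * duo if every submodule of $M$ is fully invariant; * uniform if $M\neq 0$ and every nonzero submodule of $M$ is essential in $M$; * Goldie if $M$ has finite uniform dimension (some finite direct sum of uniform submodules is essential in $M$) and satisfies the ascending chain condition on left annihilators, i.e. on submodules of the form $\bigcap_{f\in X}\mathrm{Ker}(f)$ with $X\subseteq \mathrm{End}_R(M)$. A module $N\in\sigma[M]$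 is $M$-singular if there is an exact sequence $0\to K\to L\to N\to 0$ in $\sigma[M]$ with $K$ essential in $L$; and $M$ is non-$M$-singular if $\mathcal Z(M)=0$, where $\mathcal Z(M)$ is the sum of the images $f(N)$ over all $M$-singular modules $N$ and all $f\in\mathrm{Hom}_R(N,M)$. **Theorem.** Assume that $M$ is projective in $\sigma[M]$ and is a semiprime duo module. Then the following conditions are equivalent: 1. $M$ is a prime module and a Goldie module; 2. $\widehat{M}$ is indecomposable (nonzero and not a direct sum of two nonzero submodules) and $M$ is non-$M$-singular; 3. $M$ is uniform and non-$M$-singular. -/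

import Mathlib

namespace GoldieModule

universe u v w

section Definitions

variable (R : Type u) [Ring R] (M : Type v) [AddCommGroup M] [Module R M]

/-! ### Essential, uniform and indecomposable -/

variable {R M} in
/-- `N ≤ₑ M`: the submodule `N` meets every nonzero submodule of `M` nontrivially. -/
def IsEssential (N : Submodule R M) : Prop :=
  ∀ K : Submodule R M, N ⊓ K = ⊥ → K = ⊥

/-- `M` is uniform: `M ≠ 0` and every nonzero submodule of `M` is essential. -/
def IsUniform : Prop :=
  Nontrivial M ∧ ∀ N : Submodule R M, N ≠ ⊥ → IsEssential N

/-- `M` is indecomposable: `M ≠ 0` and `M` has no decomposition `M = A ⊕ B` into nonzero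
submodules. -/
def IsIndecomposable : Prop :=
  Nontrivial M ∧ ∀ A B : Submodule R M, IsCompl A B → A = ⊥ ∨ B = ⊥

/-- `M` has finite uniform dimension: some finite direct sum of uniform submodules of `M` is
essential in `M`. -/
def HasFiniteUniformDimension : Prop :=
  ∃ (n : ℕ) (U : Fin n → Submodule R M),
    (∀ i, IsUniform R (U i)) ∧ iSupIndep U ∧ IsEssential (⨆ i, U i)

/-! ### The category `σ[M]` -/

/-- `X` belongs to `σ[M]`: it is isomorphic to a submodule of an `M`-generated module, that is, it
embeds into a quotient of a direct sum of copies of `M`. (Only as many copies of `M` as `X` has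
elements, or finitely many, are ever needed, so the universe of the index type is no restriction.)
-/
def InSigma (X : Type w) [AddCommGroup X] [Module R X] : Prop :=
  ∃ (ι : Type w) (P : Submodule R (ι →₀ M)) (f : X →ₗ[R] (ι →₀ M) ⧸ P), Function.Injective f

/-- `M` is projective in `σ[M]`: every morphism from `M` lifts along every epimorphism of `σ[M]`.
(Modules in `σ[M]` are modules over the image of `R` in `End_ℤ(M)`, and both modules can be cut
down to submodules generated over it by at most `|M|` elements, so that it is enough to take them
from the universe of `M`.) -/
def IsProjectiveInSigma : Prop :=
  ∀ (X Y : Type v) [AddCommGroup X] [AddCommGroup Y] [Module R X] [Module R Y],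
    InSigma R M X → InSigma R M Y →
      ∀ (g : X →ₗ[R] Y) (f : M →ₗ[R] Y), Function.Surjective g →
        ∃ h : M →ₗ[R] X, g ∘ₗ h = f

/-- `N ∈ σ[M]` is `M`-singular: there is an exact sequence `0 → K → L → N → 0` in `σ[M]` with
`K ≤ₑ L`. -/
def IsMSingular (N : Type w) [AddCommGroup N] [Module R N] : Prop :=
  InSigma R M N ∧
    ∃ (L : Type (max v w)) (_ : AddCommGroup L) (_ : Module R L) (g : L →ₗ[R] N),
      InSigma R M L ∧ Function.Surjective g ∧ IsEssential (LinearMap.ker g)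

/-- `𝒵(L) = ∑ f(N)`, the sum over all `M`-singular `N` and all homomorphisms `f : N → L`: the
largest `M`-singular submodule of `L`. -/
def singularSubmodule (L : Type w) [AddCommGroup L] [Module R L] : Submodule R L :=
  sSup {P | ∃ (N : Type w) (_ : AddCommGroup N) (_ : Module R N) (f : N →ₗ[R] L),
    IsMSingular R M N ∧ P = LinearMap.range f}

/-- `L` is non-`M`-singular: `𝒵(L) = 0`. -/
def IsNonMSingular (L : Type w) [AddCommGroup L] [Module R L] : Prop :=
  singularSubmodule R M L = ⊥

/-- `E` is `M`-injective: every homomorphism from a submodule of `M` to `E` extends to `M`. -/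
def IsMInjective (E : Type w) [AddCommGroup E] [Module R E] : Prop :=
  ∀ (N : Submodule R M) (g : N →ₗ[R] E), ∃ h : M →ₗ[R] E, ∀ x : N, h x = g x

/-- `j : M → E` exhibits `E` as the `M`-injective hull `M̂` of `M`, its injective hull in `σ[M]`:
`E` is an `M`-injective module in `σ[M]` and `j` is an essential embedding. It exists, see
`exists_isMInjectiveHull` below. -/
structure IsMInjectiveHull {E : Type w} [AddCommGroup E] [Module R E] (j : M →ₗ[R] E) : Prop where
  inSigma : InSigma R M E
  isMInjective : IsMInjective R M E
  injective : Function.Injective j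
  essential : IsEssential (LinearMap.range j)

/-! ### Products of submodules, prime, semiprime, Goldie and duo modules -/

variable {R M} in
/-- The product `K_M L = ∑ { f(K) | f ∈ Hom_R(M, L) }`, as a submodule of `M`. -/
def submoduleProduct (K L : Submodule R M) : Submodule R M :=
  ⨆ f : M →ₗ[R] L, K.map (L.subtype ∘ₗ f)

variable {R M} in
/-- `N` is a prime submodule in `M`. -/
def IsPrimeSubmodule (N : Submodule R M) : Prop :=
  N.IsFullyInvariant ∧ ∀ K L : Submodule R M, K.IsFullyInvariant → L.IsFullyInvariant →
    submoduleProduct K L ≤ N → K ≤ N ∨ L ≤ N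

variable {R M} in
/-- `N` is a semiprime submodule in `M`. -/
def IsSemiprimeSubmodule (N : Submodule R M) : Prop :=
  N.IsFullyInvariant ∧ ∀ K : Submodule R M, K.IsFullyInvariant →
    submoduleProduct K K ≤ N → K ≤ N

/-- `M` is a prime module: `0` is a prime submodule in `M`. -/
def IsPrimeModule : Prop := IsPrimeSubmodule (⊥ : Submodule R M)

/-- `M` is a semiprime module: `0` is a semiprime submodule in `M`. -/
def IsSemiprimeModule : Prop := IsSemiprimeSubmodule (⊥ : Submodule R M)

/-- `M` is a duo module: every submodule of `M` is fully invariant. -/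
def IsDuoModule : Prop := ∀ N : Submodule R M, N.IsFullyInvariant

variable {R M} in
/-- `A` is a left annihilator in `M`: `A = ⋂ { ker f | f ∈ X }` for some `X ⊆ End_R(M)`. -/
def IsLeftAnnihilator (A : Submodule R M) : Prop :=
  ∃ X : Set (Module.End R M), A = ⨅ f ∈ X, LinearMap.ker f

/-- Every ascending chain of left annihilators in `M` becomes stationary. -/
def HasACCOnLeftAnnihilators : Prop :=
  ∀ A : ℕ →o Submodule R M, (∀ n, IsLeftAnnihilator (A n)) → ∃ n, ∀ m, n ≤ m → A n = A m

/-- `M` is a Goldie module. -/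
def IsGoldieModule : Prop :=
  HasACCOnLeftAnnihilators R M ∧ HasFiniteUniformDimension R M

end Definitions

/-! ### Existence of the `M`-injective hull -/

section Existence

variable {R : Type u} [Ring R]

theorem exists_extend_of_baer {J : Type w} [AddCommGroup J] [Module R J] (hJ : Module.Baer R J)
    {A B : Type*} [AddCommGroup A] [Module R A] [AddCommGroup B] [Module R B]
    (i : A →ₗ[R] B) (hi : Function.Injective i) (f : A →ₗ[R] J) :
    ∃ h : B →ₗ[R] J, ∀ x, h (i x) = f x := by
  obtain ⟨h, hh⟩ := hJ.extension_property i hi f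
  exact ⟨h, fun x => by rw [← hh]; rfl⟩

theorem exists_baer_embedding (M : Type v) [AddCommGroup M] [Module R M] :
    ∃ (J : Type (max u v)) (_ : AddCommGroup J) (_ : Module R J) (i : M →ₗ[R] J),
      Module.Baer R J ∧ Function.Injective i := by
  have := ModuleCat.enoughInjectives.{v, u} R
  obtain ⟨⟨J, hJ, f, hf⟩⟩ :=
    CategoryTheory.EnoughInjectives.presentation (ModuleCat.of R (ULift.{u} M))
  have hJ' : Module.Injective R J := (Module.injective_iff_injective_object R J).2 hJ
  refine ⟨J, inferInstance, inferInstance, f.hom ∘ₗ ULift.moduleEquiv.symm.toLinearMap,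
    Module.Baer.of_injective hJ', ?_⟩
  exact ((ModuleCat.mono_iff_injective f).1 hf).comp ULift.moduleEquiv.symm.injective

/-- Inside an injective module `J`, every submodule `A` has a maximal essential extension `E`, and
`E` is a direct summand of `J`. -/
theorem exists_essential_summand {J : Type w} [AddCommGroup J] [Module R J]
    (hJ : Module.Baer R J) (A : Submodule R J) :
    ∃ E : Submodule R J, A ≤ E ∧ (∀ K ≤ E, A ⊓ K = ⊥ → K = ⊥) ∧
      ∃ p : J →ₗ[R] E, ∀ x : E, p x = x := by
  obtain ⟨E, hAE, hE⟩ := zorn_le_nonempty₀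
    {E : Submodule R J | A ≤ E ∧ ∀ K ≤ E, A ⊓ K = ⊥ → K = ⊥} (by
      intro c hc hchain y hy
      refine ⟨sSup c, ⟨(hc hy).1.trans (le_sSup hy), ?_⟩, fun z hz => le_sSup hz⟩
      intro K hK hAK
      rw [eq_bot_iff]
      intro x hx
      obtain ⟨z, hz, hxz⟩ := (Submodule.mem_sSup_of_directed ⟨y, hy⟩ hchain.directedOn).1 (hK hx)
      have := (hc hz).2 (K ⊓ z) inf_le_right (by
        rw [← inf_assoc, hAK, bot_inf_eq])
      exact this ▸ (⟨hx, hxz⟩ : x ∈ K ⊓ z)) A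
    ⟨le_rfl, fun K hK h => by rwa [inf_eq_right.2 hK] at h⟩
  obtain ⟨⟨-, hess⟩, hmax⟩ := hE
  obtain ⟨C, -, hC⟩ := zorn_le_nonempty₀ {C : Submodule R J | E ⊓ C = ⊥} (by
      intro c hc hchain y hy
      refine ⟨sSup c, ?_, fun z hz => le_sSup hz⟩
      show E ⊓ sSup c = ⊥
      rw [eq_bot_iff]
      rintro x ⟨hxE, hx⟩
      obtain ⟨z, hz, hxz⟩ := (Submodule.mem_sSup_of_directed ⟨y, hy⟩ hchain.directedOn).1 hx
      exact (hc hz : E ⊓ z = ⊥) ▸ (⟨hxE, hxz⟩ : x ∈ E ⊓ z)) ⊥ (by simp)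
  obtain ⟨hEC, hCmax⟩ := hC
  replace hEC : E ⊓ C = ⊥ := hEC
  have hker : Function.Injective (C.mkQ ∘ₗ E.subtype) := by
    rw [← LinearMap.ker_eq_bot, eq_bot_iff]
    intro x hx
    have hx' : (x : J) ∈ C := by simpa using hx
    have : (x : J) ∈ E ⊓ C := ⟨x.2, hx'⟩
    rw [hEC] at this
    simpa using this
  obtain ⟨φ, hφ⟩ := exists_extend_of_baer hJ (C.mkQ ∘ₗ E.subtype) hker E.subtype
  replace hφ : ∀ x : E, φ (C.mkQ x) = x := hφ
  -- a submodule above `C` on which `φ ∘ mkQ` avoids `E` equals `C`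
  have key : ∀ D : Submodule R J, C ≤ D → E ⊓ D = ⊥ → D = C := fun D h1 h2 =>
    le_antisymm (hCmax h2 h1) h1
  have hrange : LinearMap.range (φ ∘ₗ C.mkQ) ≤ E := by
    refine hmax ⟨hAE.trans fun x hx => ⟨x, hφ ⟨x, hx⟩⟩, ?_⟩ fun x hx => ⟨x, hφ ⟨x, hx⟩⟩
    intro K hK hAK
    have hEK : E ⊓ K = ⊥ := hess _ inf_le_left (by rw [← inf_assoc, inf_eq_left.2 hAE, hAK])
    have hEK' : E ⊓ K.comap (φ ∘ₗ C.mkQ) = ⊥ := by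
      rw [eq_bot_iff]
      rintro x ⟨hxE, hxK⟩
      have h2 : φ (C.mkQ x) ∈ K := hxK
      rw [hφ ⟨x, hxE⟩] at h2
      exact hEK ▸ (⟨hxE, h2⟩ : x ∈ E ⊓ K)
    have hKC := key _ (fun x hx => by
      have h0 : C.mkQ x = 0 := by simpa using hx
      show φ (C.mkQ x) ∈ K
      rw [h0, map_zero]; exact K.zero_mem) hEK'
    rw [eq_bot_iff]
    intro y hy
    obtain ⟨x, rfl⟩ := hK hy
    have hxC : x ∈ C := hKC ▸ (show x ∈ K.comap (φ ∘ₗ C.mkQ) from hy)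
    have h0 : C.mkQ x = 0 := by simpa using hxC
    show φ (C.mkQ x) = 0
    rw [h0, map_zero]
  exact ⟨E, hAE, hess, (φ ∘ₗ C.mkQ).codRestrict E fun x => hrange ⟨x, rfl⟩,
    fun x => Subtype.ext (hφ x)⟩

/-- Every module has an `M`-injective hull. -/
theorem exists_isMInjectiveHull (M : Type v) [AddCommGroup M] [Module R M] :
    ∃ (E : Type (max u v)) (_ : AddCommGroup E) (_ : Module R E) (j : M →ₗ[R] E),
      IsMInjectiveHull R M j := by
  obtain ⟨J, _, _, i, hJ, hi⟩ := exists_baer_embedding (R := R) M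
  obtain ⟨E, hAE, hess, p, hp⟩ := exists_essential_summand hJ (LinearMap.range i)
  -- the trace of `M` in the injective hull `E`
  let T : Submodule R J := ⨆ f : M →ₗ[R] E, LinearMap.range (E.subtype ∘ₗ f)
  have hfT : ∀ (f : M →ₗ[R] E) (x : M), (f x : J) ∈ T := fun f x =>
    (le_iSup (fun f : M →ₗ[R] E => LinearMap.range (E.subtype ∘ₗ f)) f) ⟨x, rfl⟩
  have hTE : T ≤ E := iSup_le fun f => by
    rintro _ ⟨x, rfl⟩; exact (f x).2
  have hiT : ∀ x, i x ∈ T := fun x =>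
    hfT (i.codRestrict E fun x => hAE ⟨x, rfl⟩) x
  refine ⟨T, inferInstance, inferInstance, i.codRestrict T hiT, ?_, ?_, ?_, ?_⟩
  · -- the trace is an epimorphic image of a direct sum of copies of `M`
    let g : ((M →ₗ[R] E) →₀ M) →ₗ[R] T :=
      Finsupp.lsum ℕ fun f => (E.subtype ∘ₗ f).codRestrict T (hfT f)
    have hg : Function.Surjective g := by
      have h1 : T ≤ LinearMap.range (T.subtype ∘ₗ g) := iSup_le fun f => by
        rintro _ ⟨x, rfl⟩
        exact ⟨Finsupp.single f x, by simp [g]; rfl⟩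
      intro t
      obtain ⟨s, hs⟩ := h1 t.2
      exact ⟨s, Subtype.ext hs⟩
    exact ⟨M →ₗ[R] E, LinearMap.ker g, (g.quotKerEquivOfSurjective hg).symm.toLinearMap,
      (g.quotKerEquivOfSurjective hg).symm.injective⟩
  · intro N g
    obtain ⟨h, hh⟩ := exists_extend_of_baer hJ N.subtype N.injective_subtype (T.subtype ∘ₗ g)
    refine ⟨(E.subtype ∘ₗ p ∘ₗ h).codRestrict T fun x => hfT (p ∘ₗ h) x, fun x => ?_⟩
    apply Subtype.ext
    show (p (h x) : J) = g x
    have h1 : h x = g x := hh x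
    rw [h1, hp ⟨g x, hTE (g x).2⟩]
  · exact fun x y hxy => hi (congrArg Subtype.val hxy)
  · intro K hK
    have h1 := hess (K.map T.subtype) (by
      rintro _ ⟨x, -, rfl⟩; exact hTE x.2) (by
      rw [eq_bot_iff]
      rintro _ ⟨⟨m, hm⟩, ⟨x, hx, rfl⟩⟩
      have : x ∈ LinearMap.range (i.codRestrict T hiT) ⊓ K := ⟨⟨m, Subtype.ext hm⟩, hx⟩
      rw [hK] at this
      simpa using this)
    exact Submodule.map_injective_of_injective T.injective_subtype (h1.trans (Submodule.map_bot _).symm)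

end Existence

end GoldieModule

namespace GoldieModule

/-! ### Injectivity relative to the modules of `σ[M]`. -/

section RelativeInjectivity

variable {R : Type*} [Ring R] {M X Y E : Type*} [AddCommGroup M] [Module R M]
  [AddCommGroup X] [Module R X] [AddCommGroup Y] [Module R Y] [AddCommGroup E] [Module R E]

/-! Uniformity of `M` is the hub. In a duo module `K_M L ≤ K ⊓ L`, so primeness makes nonzero
submodules meet. Conversely, the square of `K ⊓ L` lies in `K_M L`, so a semiprime uniform duo
module is prime. The hull is `M`-injective and lies in `σ[M]`, hence is injective relative to
itself. Disjoint submodules of it therefore lie in complementary summands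
(`IsMInjective.exists_isCompl`), and essentiality of `M` matches indecomposability with uniformity.
For singularity, `isReduced_end` shows that the endomorphism ring has no nonzero nilpotents, while
the chain condition makes endomorphisms with essential kernel nilpotent, hence zero. Conversely,
over a uniform nonsingular `M` every nonzero endomorphism is injective, so the only left
annihilators are `0` and `M`. -/

theorem IsMInjective.exists_extend (hE : IsMInjective R X E) (i : Y →ₗ[R] X)
    (hi : Function.Injective i) (f : Y →ₗ[R] E) : ∃ h : X →ₗ[R] E, ∀ y, h (i y) = f y := by
  obtain ⟨h, hh⟩ := hE (LinearMap.range i) (f ∘ₗ (LinearEquiv.ofInjective i hi).symm.toLinearMap)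
  refine ⟨h, fun y => ?_⟩
  have h1 := hh (LinearEquiv.ofInjective i hi y)
  simpa using h1

theorem IsMInjective.of_injective (hE : IsMInjective R X E) (i : Y →ₗ[R] X)
    (hi : Function.Injective i) : IsMInjective R Y E := by
  intro N g
  obtain ⟨h, hh⟩ := hE.exists_extend (i ∘ₗ N.subtype) (hi.comp N.injective_subtype) g
  exact ⟨h ∘ₗ i, hh⟩

/-- An `M`-injective module is injective relative to every `M`-generated module. -/
theorem IsMInjective.of_iSup_range_eq_top (hE : IsMInjective R M E) {ι : Type*}
    (f : ι → M →ₗ[R] X) (hf : ⨆ i, LinearMap.range (f i) = ⊤) : IsMInjective R X E := by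
  intro N g
  -- Take a maximal partial extension `q` of `g`; its domain will be shown to contain every `range
  -- (f i)`.
  obtain ⟨q, hgq, hq⟩ := zorn_le_nonempty₀ {p : X →ₗ.[R] E | (⟨N, g⟩ : X →ₗ.[R] E) ≤ p} (by
    intro c hc hchain y hy
    refine ⟨LinearPMap.sSup c hchain.directedOn, ?_,
      fun z hz => LinearPMap.le_sSup hchain.directedOn hz⟩
    exact le_trans (hc hy) (LinearPMap.le_sSup hchain.directedOn hy)) ⟨N, g⟩
    (le_refl (⟨N, g⟩ : X →ₗ.[R] E))
  have hdom : q.domain = ⊤ := by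
    rw [eq_top_iff, ← hf]
    refine iSup_le fun i => ?_
    obtain ⟨h, hh⟩ := hE (q.domain.comap (f i))
      (q.toFun ∘ₗ ((f i).restrict (p := q.domain.comap (f i)) (q := q.domain) fun x hx => hx))
    -- The kernel of `f i` lies in the preimage of the domain, where `h` is `q ∘ f i`. So `h`
    -- descends to `range (f i)` and can be glued to `q`.
    have hker : LinearMap.ker (f i) ≤ LinearMap.ker h := by
      intro x hx
      have hx0 : f i x = 0 := hx
      have hxm : x ∈ q.domain.comap (f i) := by simp [hx0]
      have h1 := hh ⟨x, hxm⟩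
      have h2 : (f i).restrict (p := q.domain.comap (f i)) (q := q.domain)
          (fun x hx => hx) ⟨x, hxm⟩ = 0 := Subtype.ext hx0
      rw [LinearMap.comp_apply, h2, map_zero] at h1
      exact h1
    let k : LinearMap.range (f i) →ₗ[R] E :=
      (LinearMap.ker (f i)).liftQ h hker ∘ₗ (f i).quotKerEquivRange.symm.toLinearMap
    have hk : ∀ x, k ⟨f i x, x, rfl⟩ = h x := by
      intro x
      have h1 : (f i).quotKerEquivRange.symm ⟨f i x, x, rfl⟩ =
          (LinearMap.ker (f i)).mkQ x := by
        rw [LinearEquiv.symm_apply_eq]; rfl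
      change (LinearMap.ker (f i)).liftQ h hker
        ((f i).quotKerEquivRange.symm ⟨f i x, x, rfl⟩) = h x
      rw [h1]; rfl
    let p : X →ₗ.[R] E := ⟨LinearMap.range (f i), k⟩
    have hagree : ∀ (x : q.domain) (y : p.domain), (x : X) = y → q x = p y := by
      rintro ⟨x, hx⟩ ⟨_, ⟨y, rfl⟩⟩ hxy
      obtain rfl : x = f i y := hxy
      exact (hh ⟨y, hx⟩).symm.trans (hk y).symm
    have hle := hq.2 (le_trans hgq (LinearPMap.left_le_sup q p hagree))
      (LinearPMap.left_le_sup q p hagree)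
    exact le_trans (LinearPMap.right_le_sup q p hagree).1 hle.1
  refine ⟨q.toFun ∘ₗ (LinearMap.id.codRestrict q.domain fun x => hdom ▸ Submodule.mem_top),
    fun x => ?_⟩
  exact (hgq.2 (x := x) (y := ⟨x, hgq.1 x.2⟩) rfl).symm

theorem IsMInjective.of_inSigma (hE : IsMInjective R M E) (hX : InSigma R M X) :
    IsMInjective R X E := by
  obtain ⟨ι, P, i, hi⟩ := hX
  refine IsMInjective.of_injective (hE.of_iSup_range_eq_top
    (fun a : ι => P.mkQ ∘ₗ Finsupp.lsingle a) ?_) i hi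
  simp_rw [LinearMap.range_comp]
  rw [← Submodule.map_iSup, Finsupp.iSup_lsingle_range, Submodule.map_top, Submodule.range_mkQ]

end RelativeInjectivity

/-! ### Splitting self-injective modules. -/

section Complements

variable {R : Type*} [Ring R] {X : Type*} [AddCommGroup X] [Module R X]

theorem exists_maximal_disjoint {A B : Submodule R X} (h : A ⊓ B = ⊥) :
    ∃ C, B ≤ C ∧ A ⊓ C = ⊥ ∧ ∀ D, C ≤ D → A ⊓ D = ⊥ → D = C := by
  obtain ⟨C, hBC, hC⟩ := zorn_le_nonempty₀ {C : Submodule R X | A ⊓ C = ⊥} (by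
    intro c hc hchain y hy
    refine ⟨sSup c, ?_, fun z hz => le_sSup hz⟩
    change A ⊓ sSup c = ⊥
    rw [eq_bot_iff]
    rintro x ⟨hxA, hx⟩
    obtain ⟨z, hz, hxz⟩ := (Submodule.mem_sSup_of_directed ⟨y, hy⟩ hchain.directedOn).1 hx
    exact (hc hz : A ⊓ z = ⊥) ▸ (⟨hxA, hxz⟩ : x ∈ A ⊓ z)) B h
  exact ⟨C, hBC, hC.1, fun D h1 h2 => le_antisymm (hC.2 h2 h1) h1⟩

/-- In a self-injective module, two independent submodules are separated by a decomposition. -/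
theorem IsMInjective.exists_isCompl (hX : IsMInjective R X X) {A B : Submodule R X}
    (h : A ⊓ B = ⊥) : ∃ A' B' : Submodule R X, A ≤ A' ∧ B ≤ B' ∧ IsCompl A' B' := by
  obtain ⟨C, hBC, hAC, hCmax⟩ := exists_maximal_disjoint h
  obtain ⟨D, hAD, hCD, hDmax⟩ := exists_maximal_disjoint (inf_comm A C ▸ hAC)
  have hinj : Function.Injective (D.subtype.coprod C.subtype) := by
    rw [← LinearMap.ker_eq_bot, LinearMap.ker_coprod_of_disjoint_range]
    · simp
    · simpa [disjoint_iff, inf_comm] using hCD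
  -- `e` extends the projection of `D ⊕ C` onto `D`. Maximality of `C` and `D` will make it an
  -- idempotent with range exactly `D`.
  obtain ⟨e, he⟩ := hX.exists_extend (D.subtype.coprod C.subtype) hinj
    (D.subtype ∘ₗ LinearMap.fst R D C)
  have heD : ∀ x ∈ D, e x = x := fun x hx => by simpa using he (⟨x, hx⟩, 0)
  have heC : ∀ x ∈ C, e x = 0 := fun x hx => by simpa using he (0, ⟨x, hx⟩)
  have hcomap : C.comap e = C := by
    refine hCmax _ (fun x hx => ?_) ?_
    · rw [Submodule.mem_comap, heC x hx]; exact C.zero_mem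
    · rw [eq_bot_iff, ← hCD]
      rintro x ⟨hxA, hxC⟩
      rw [SetLike.mem_coe, Submodule.mem_comap, heD x (hAD hxA)] at hxC
      exact ⟨hxC, hAD hxA⟩
  -- If `e x ∈ C`, then `x ∈ C` by `hcomap`, so `e x = 0`: the range meets `C` trivially.
  have hrange : LinearMap.range e = D := by
    refine hDmax _ (fun x hx => ⟨x, heD x hx⟩) ?_
    rw [eq_bot_iff]
    rintro _ ⟨hxC, ⟨x, rfl⟩⟩
    have hx : x ∈ C := hcomap ▸ (show x ∈ C.comap e from hxC)
    exact heC x hx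
  have hidem : ∀ x, e (e x) = e x := fun x => heD _ (hrange ▸ ⟨x, rfl⟩)
  refine ⟨D, LinearMap.ker e, hAD, fun x hx => heC x (hBC hx), ?_, ?_⟩
  · rw [Submodule.disjoint_def]
    intro x hx hx0
    rw [← heD x hx]; exact hx0
  · rw [codisjoint_iff, eq_top_iff]
    intro x _
    refine Submodule.mem_sup.2 ⟨e x, hrange ▸ ⟨x, rfl⟩, x - e x, ?_, by abel⟩
    simp [hidem]

end Complements

/-! ### Uniform modules and indecomposable hulls. -/

section Hull

variable {R : Type*} [Ring R] {M E : Type*} [AddCommGroup M] [Module R M]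
  [AddCommGroup E] [Module R E] {j : M →ₗ[R] E}

theorem IsMInjectiveHull.isUniform_of_isIndecomposable (hj : IsMInjectiveHull R M j)
    (hE : IsIndecomposable R E) : IsUniform R M := by
  have hne : LinearMap.range j ≠ ⊥ := by
    intro h0
    have htop := hj.essential ⊤ (by rw [h0, bot_inf_eq])
    have := hE.1
    exact top_ne_bot htop
  refine ⟨?_, fun K hK L hKL => ?_⟩
  · by_contra hM
    rw [not_nontrivial_iff_subsingleton] at hM
    exact hne (LinearMap.range_eq_bot.2 (Subsingleton.elim j 0))
  · have hdisj : K.map j ⊓ L.map j = ⊥ := by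
      rw [← Submodule.map_inf _ hj.injective, hKL, Submodule.map_bot]
    obtain ⟨A, B, hA, hB, hAB⟩ :=
      (hj.isMInjective.of_inSigma hj.inSigma).exists_isCompl hdisj
    have hbot : ∀ N : Submodule R M, N.map j = ⊥ → N = ⊥ := fun N hN =>
      Submodule.map_injective_of_injective hj.injective (hN.trans (Submodule.map_bot _).symm)
    rcases hE.2 A B hAB with h | h
    · exact (hK (hbot K (le_bot_iff.1 (h ▸ hA)))).elim
    · exact hbot L (le_bot_iff.1 (h ▸ hB))

/-- By essentiality, nonzero summands of the hull would pull back to nonzero disjoint submodules of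
`M`. -/
theorem IsMInjectiveHull.isIndecomposable_of_isUniform (hj : IsMInjectiveHull R M j)
    (hM : IsUniform R M) : IsIndecomposable R E := by
  have := hM.1
  refine ⟨hj.injective.nontrivial, fun A B hAB => ?_⟩
  have key : ∀ N : Submodule R E, N.comap j = ⊥ → N = ⊥ := by
    intro N hN
    refine hj.essential N ?_
    rw [← Submodule.map_comap_eq, hN, Submodule.map_bot]
  by_contra! hne
  refine hne.2 (key B (hM.2 (A.comap j) (fun h => hne.1 (key A h)) _ ?_))
  rw [← Submodule.comap_inf, hAB.inf_eq_bot, Submodule.comap_bot, LinearMap.ker_eq_bot]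
  exact hj.injective

end Hull

/-! ### Primeness, chain conditions and singularity. -/

section Sigma

variable {R : Type*} [Ring R] {M : Type*} [AddCommGroup M] [Module R M]

theorem inSigma_submodule (N : Submodule R M) : InSigma R M N := by
  refine ⟨PUnit, ⊥, (⊥ : Submodule R (PUnit →₀ M)).mkQ ∘ₗ Finsupp.lsingle PUnit.unit ∘ₗ N.subtype,
    ?_⟩
  refine Function.Injective.comp (g := (⊥ : Submodule R (PUnit →₀ M)).mkQ) ?_
    ((Finsupp.single_injective _).comp N.injective_subtype)
  rw [← LinearMap.ker_eq_bot, Submodule.ker_mkQ]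

theorem inSigma_self : InSigma R M M := by
  obtain ⟨ι, P, f, hf⟩ := inSigma_submodule (⊤ : Submodule R M)
  exact ⟨ι, P, f ∘ₗ Submodule.topEquiv.symm.toLinearMap, hf.comp Submodule.topEquiv.symm.injective⟩

theorem submoduleProduct_mono {K K' L L' : Submodule R M} (hK : K ≤ K') (hL : L ≤ L') :
    submoduleProduct K L ≤ submoduleProduct K' L' := by
  refine iSup_le fun f => le_trans (Submodule.map_mono hK) ?_
  exact le_iSup (fun f : M →ₗ[R] L' => K'.map (L'.subtype ∘ₗ f)) (Submodule.inclusion hL ∘ₗ f)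

theorem submoduleProduct_le_inf {K L : Submodule R M} (hK : K.IsFullyInvariant) :
    submoduleProduct K L ≤ K ⊓ L := by
  refine iSup_le fun f => ?_
  rintro _ ⟨x, hx, rfl⟩
  exact ⟨hK (L.subtype ∘ₗ f) hx, (f x).2⟩

/-- An endomorphism of a non-`M`-singular module `M` with essential kernel vanishes. -/
theorem IsNonMSingular.eq_zero_of_isEssential_ker (hM : IsNonMSingular R M M)
    (f : Module.End R M) (hf : IsEssential (LinearMap.ker f)) : f = 0 := by
  have hle : LinearMap.range f ≤ singularSubmodule R M M := by
    refine le_sSup ⟨LinearMap.range f, inferInstance, inferInstance,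
      (LinearMap.range f).subtype, ⟨inSigma_submodule _, M, inferInstance, inferInstance,
        f.rangeRestrict, inSigma_self, f.surjective_rangeRestrict, ?_⟩, ?_⟩
    · rwa [LinearMap.ker_rangeRestrict]
    · rw [Submodule.range_subtype]
  rw [hM, le_bot_iff, LinearMap.range_eq_bot] at hle
  exact hle

theorem isPrimeModule_of_isUniform (hs : IsSemiprimeModule R M) (hd : IsDuoModule R M)
    (hu : IsUniform R M) : IsPrimeModule R M := by
  refine ⟨hd _, fun K L _ _ hKL => ?_⟩
  by_contra! hne
  rw [le_bot_iff, le_bot_iff] at hne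
  refine hne.2 (hu.2 K hne.1 L (le_bot_iff.1 (hs.2 (K ⊓ L) (hd _) ?_)))
  exact (submoduleProduct_mono inf_le_left inf_le_right).trans hKL

theorem isUniform_of_isPrimeModule [Nontrivial M] (hp : IsPrimeModule R M)
    (hd : IsDuoModule R M) : IsUniform R M := by
  refine ⟨inferInstance, fun K hK L hKL => ?_⟩
  have h := hp.2 K L (hd K) (hd L) (hKL ▸ submoduleProduct_le_inf (hd K))
  rw [le_bot_iff, le_bot_iff] at h
  exact h.resolve_left hK

theorem hasFiniteUniformDimension_of_isUniform (hu : IsUniform R M) :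
    HasFiniteUniformDimension R M := by
  have := hu.1
  refine ⟨1, fun _ => ⊤, fun _ => ⟨Submodule.topEquiv.toEquiv.nontrivial, fun N hN K hNK => ?_⟩, iSupIndep_subsingleton _,
    fun K hK => by simpa using hK⟩
  have hinj := (⊤ : Submodule R M).injective_subtype
  have hbot : ∀ L : Submodule R (⊤ : Submodule R M), L.map (⊤ : Submodule R M).subtype = ⊥ →
      L = ⊥ := fun L hL =>
    Submodule.map_injective_of_injective hinj (hL.trans (Submodule.map_bot _).symm)
  refine hbot K (hu.2 _ (fun h => hN (hbot N h)) _ ?_)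
  rw [← Submodule.map_inf _ hinj, hNK, Submodule.map_bot]

theorem hasACCOnLeftAnnihilators_of_isUniform (hu : IsUniform R M)
    (hM : IsNonMSingular R M M) : HasACCOnLeftAnnihilators R M := by
  have hdich : ∀ A : Submodule R M, IsLeftAnnihilator A → A ≠ ⊥ → A = ⊤ := by
    rintro _ ⟨X, rfl⟩ hne
    rw [eq_top_iff]
    refine le_iInf₂ fun f hf => ?_
    have hker : LinearMap.ker f ≠ ⊥ := fun h =>
      hne (le_bot_iff.1 (h ▸ iInf₂_le (f := fun f (_ : f ∈ X) => LinearMap.ker f) f hf))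
    rw [hM.eq_zero_of_isEssential_ker f (hu.2 _ hker), LinearMap.ker_zero]
  intro A hA
  by_cases h : ∀ n, A n = ⊥
  · exact ⟨0, fun m _ => (h 0).trans (h m).symm⟩
  · push Not at h
    obtain ⟨n, hn⟩ := h
    have hn' := hdich _ (hA n) hn
    exact ⟨n, fun m hm => hn'.trans (top_le_iff.1 (hn' ▸ A.monotone hm)).symm⟩

/-- The chain condition on left annihilators makes every endomorphism with essential kernel
nilpotent. -/
theorem HasACCOnLeftAnnihilators.isNilpotent_of_isEssential_ker
    (hM : HasACCOnLeftAnnihilators R M) (g : Module.End R M)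
    (hg : IsEssential (LinearMap.ker g)) : IsNilpotent g := by
  obtain ⟨n, hn⟩ := hM g.iterateKer fun n => ⟨{g ^ n}, by simp⟩
  have hn' : ∀ m, n ≤ m → LinearMap.ker (g ^ n) = LinearMap.ker (g ^ m) := hn
  refine ⟨n + 1, LinearMap.range_eq_bot.1 (hg _ ?_)⟩
  rw [eq_bot_iff]
  -- If `g` kills `g ^ (n + 1) x`, then `x` lies in `ker (g ^ (n + 2))`, which equals `ker (g ^ (n +
  -- 1))` by stability.
  rintro _ ⟨hx, ⟨x, rfl⟩⟩
  have h1 : x ∈ LinearMap.ker (g ^ (n + 1 + 1)) := by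
    rw [LinearMap.mem_ker, pow_succ' g (n + 1)]; exact hx
  rw [← hn' _ (by omega), hn' (n + 1) (by omega)] at h1
  exact h1

/-- The endomorphism ring of a semiprime duo module `M` that is projective in `σ[M]` is reduced. -/
theorem isReduced_end (hproj : IsProjectiveInSigma R M) (hs : IsSemiprimeModule R M)
    (hd : IsDuoModule R M) : IsReduced (Module.End R M) := by
  refine isReduced_iff_pow_one_lt 2 one_lt_two |>.2 fun g hg => ?_
  rw [← LinearMap.range_eq_bot, ← le_bot_iff]
  refine hs.2 _ (hd _) (iSup_le fun f => ?_)
  -- Projectivity writes `f` as `g ∘ h`. Since `h` preserves `range g` by the duo property, `f` maps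
  -- `range g` into `range (g ^ 2) = 0`.
  obtain ⟨h, hh⟩ := hproj M (LinearMap.range g) inSigma_self (inSigma_submodule _)
    g.rangeRestrict f g.surjective_rangeRestrict
  rintro _ ⟨x, hx, rfl⟩
  obtain ⟨y, hy⟩ := hd (LinearMap.range g) h hx
  have h1 : (f x : M) = g (h x) := by rw [← hh]; rfl
  change (f x : M) = 0
  rw [h1, ← hy]
  simpa [pow_two] using LinearMap.congr_fun hg y

theorem IsEssential.comap {X Y : Type*} [AddCommGroup X] [Module R X] [AddCommGroup Y]
    [Module R Y] {N : Submodule R Y} (hN : IsEssential N) (f : X →ₗ[R] Y) :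
    IsEssential (N.comap f) := by
  intro K hK
  have hmap : K.map f = ⊥ := by
    refine hN _ ?_
    rw [eq_bot_iff]
    rintro _ ⟨hy, ⟨x, hx, rfl⟩⟩
    have hx0 : x ∈ N.comap f ⊓ K := ⟨hy, hx⟩
    rw [hK, Submodule.mem_bot] at hx0
    simp [hx0]
  refine le_bot_iff.1 (hK ▸ le_inf (fun x hx => ?_) le_rfl)
  have h0 : f x ∈ K.map f := ⟨x, hx, rfl⟩
  rw [hmap, Submodule.mem_bot] at h0
  rw [Submodule.mem_comap, h0]
  exact N.zero_mem

theorem IsEssential.mono {N N' : Submodule R M} (hN : IsEssential N) (h : N ≤ N') :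
    IsEssential N' :=
  fun K hK => hN K (le_bot_iff.1 (hK ▸ inf_le_inf_right K h))

/-- A map from `M` to an image of a singular module lifts to `L`, so its kernel contains the
preimage of an essential submodule. It is then nilpotent, hence zero. The image thus has zero square
and vanishes by semiprimeness. -/
theorem isNonMSingular_of_hasACC (hproj : IsProjectiveInSigma R M)
    (hs : IsSemiprimeModule R M) (hd : IsDuoModule R M) (hM : HasACCOnLeftAnnihilators R M) :
    IsNonMSingular R M M := by
  have := isReduced_end hproj hs hd
  refine le_bot_iff.1 (sSup_le ?_)
  rintro _ ⟨N, _, _, f, ⟨-, L, _, _, p, hL, hp, hess⟩, rfl⟩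
  refine hs.2 _ (hd _) (iSup_le fun g => ?_)
  obtain ⟨h, hh⟩ := hproj L (LinearMap.range f) hL (inSigma_submodule _)
    (f.rangeRestrict ∘ₗ p) g (f.surjective_rangeRestrict.comp hp)
  have hker : IsEssential (LinearMap.ker ((LinearMap.range f).subtype ∘ₗ g)) := by
    refine (hess.comap h).mono fun x hx => ?_
    have hx0 : p (h x) = 0 := hx
    rw [LinearMap.mem_ker, ← hh]
    simp [hx0]
  rw [(hM.isNilpotent_of_isEssential_ker _ hker).eq_zero, Submodule.map_zero]

end Sigma

end GoldieModule

theorem theorem3p7 {R : Type*} [Ring R] {M : Type*} [AddCommGroup M] [Module R M] [Nontrivial M]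
    (hproj : GoldieModule.IsProjectiveInSigma R M)
    (hsemiprime : GoldieModule.IsSemiprimeModule R M)
    (hduo : GoldieModule.IsDuoModule R M)
    {Mhat : Type*} [AddCommGroup Mhat] [Module R Mhat] (j : M →ₗ[R] Mhat)
    (hhat : GoldieModule.IsMInjectiveHull R M j) :
    List.TFAE [
      GoldieModule.IsPrimeModule R M ∧ GoldieModule.IsGoldieModule R M,
      GoldieModule.IsIndecomposable R Mhat ∧ GoldieModule.IsNonMSingular R M M,
      GoldieModule.IsUniform R M ∧ GoldieModule.IsNonMSingular R M M] := by
  tfae_have 1 → 3 := fun h => ⟨GoldieModule.isUniform_of_isPrimeModule h.1 hduo,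
    GoldieModule.isNonMSingular_of_hasACC hproj hsemiprime hduo h.2.1⟩
  tfae_have 3 → 1 := fun h => ⟨GoldieModule.isPrimeModule_of_isUniform hsemiprime hduo h.1,
    GoldieModule.hasACCOnLeftAnnihilators_of_isUniform h.1 h.2,
    GoldieModule.hasFiniteUniformDimension_of_isUniform h.1⟩
  tfae_have 2 → 3 := fun h => ⟨hhat.isUniform_of_isIndecomposable h.1, h.2⟩
  tfae_have 3 → 2 := fun h => ⟨hhat.isIndecomposable_of_isUniform h.1, h.2⟩
  tfae_finish
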